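/- For a simple graph $G$ on a finite vertex set $V$ and a bipartition $f:V\to\{L,R\}$, let $$d_{bip}(G,f)=\sum_{v:\,f(v)=L}|N(v)\cap f^{-1}(L)|+\sum_{v:\,f(v)=R}|N(v)\cap f^{-1}(R)|,\qquad d_{bip}(G)=\min_f d_{bip}(G,f),$$ so every monochromatic edge is counted from both of its endpoints. A (randomized, adaptive) adjacency-query algorithm for graphs on $n$ vertices is a probability distribution over deterministic decision trees, each of whose inner nodes asks whether two given vertices are adjacent; its number of queries is the worst-case depth. For $x>0$, a quantity is $\widetilde{O}(x^6)$ if it is at most $C\,x^6\log^m(1+x)$, where $C$ and $m$ are absolute constants. Theorem. 1. For all $n$ and $\varepsilon\in(0,1)$ there is an algorithm that performs $\widetilde{O}(1/\varepsilon^6)$ adjacency queries to an unknown $n$-vertex graph $G$ and outputs a real number $\widehat d_{bip}(G)$ such that, for every $G$, with probability at least $9/10$, $$d_{bip}(G)-\varepsilon n^2\le \widehat d_{bip}(G)\le d_{bip}(G)+\varepsilon n^2 .$$ 2. For all $n\ge 1$, $\varepsilon\in(0,1)$ and $c>0$ there is an algorithm that performs $\widetilde{O}(1/\varepsilon^6)$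 adjacency queries to an unknown $n$-vertex graph $G$ and decides, with probability at least $9/10$, whether $d_{bip}(G)\le\varepsilon n^2$ or $d_{bip}(G)\ge(2+c)\varepsilon n^2$ (if neither holds, any answer is allowed). 3. For all $n\ge 1$, $\varepsilon\in(0,1)$ and $k>0$ there is an algorithm that performs $\widetilde{O}(1/(k^6\varepsilon^6))$ adjacency queries to an unknown $n$-vertex graph $G$ and decides, with probability at least $9/10$, whether $d_{bip}(G)\le\varepsilon n^2$ or $d_{bip}(G)\ge(1+k)\varepsilon n^2$ (if neither holds, any answer is allowed). -/

import Mathlib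

/-- The bipartite distance of `G` with respect to the bipartition `f` (`false` is the left side,
`true` is the right side): the sum, over all vertices, of the number of neighbours lying on the
same side. Each monochromatic edge is therefore counted twice. -/
noncomputable def bipDistWith {V : Type} [Fintype V] (G : SimpleGraph V) (f : V → Bool) : ℕ :=
  (∑ v : V with f v = false, (G.neighborSet v ∩ f ⁻¹' {false}).ncard) +
    ∑ v : V with f v = true, (G.neighborSet v ∩ f ⁻¹' {true}).ncard

/-- The bipartite distance of `G`: the minimum over all bipartitions. -/
noncomputable def bipDist {V : Type} [Fintype V] (G : SimpleGraph V) : ℕ :=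
  ⨅ f : V → Bool, bipDistWith G f

/-- Deterministic adaptive algorithms with adjacency-query access to an unknown graph on the
vertex set `V` and with output in `α`: either stop with an output, or ask whether `u` and `v` are
adjacent and continue according to the answer. -/
inductive AdjQueryTree (V α : Type) : Type
  | output (a : α) : AdjQueryTree V α
  | query (u v : V) (next : Bool → AdjQueryTree V α) : AdjQueryTree V α

namespace AdjQueryTree

/-- The worst-case number of adjacency queries. -/
def depth {V α : Type} : AdjQueryTree V α → ℕ
  | output _ => 0
  | query _ _ next => 1 + max (depth (next false)) (depth (next true))

open Classical in
/-- The output of the algorithm on the graph `G`. -/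
noncomputable def run {V α : Type} (G : SimpleGraph V) : AdjQueryTree V α → α
  | output a => a
  | query u v next => run G (next (decide (G.Adj u v)))

end AdjQueryTree

/-- Randomized adjacency-query algorithms: probability distributions over deterministic ones. -/
abbrev RandQueryAlg (V α : Type) : Type := PMF (AdjQueryTree V α)

namespace RandQueryAlg

/-- Whatever its random choices and the answers are, `A` performs at most `q` queries. -/
def QueriesAtMost {V α : Type} (A : RandQueryAlg V α) (q : ℝ) : Prop :=
  ∀ T ∈ A.support, (T.depth : ℝ) ≤ q

/-- The probability that the output of `A` on the graph `G` lies in `S`. -/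
noncomputable def probOutput {V α : Type} (A : RandQueryAlg V α) (G : SimpleGraph V)
    (S : Set α) : ENNReal :=
  A.toOuterMeasure {T | T.run G ∈ S}

/-- `A` decides, with success probability at least `9/10` on every graph, whether
`d_bip(G) ≤ a` (answer `true`) or `d_bip(G) ≥ b` (answer `false`). -/
def DecidesBipDist {V : Type} [Fintype V] (A : RandQueryAlg V Bool) (a b : ℝ) : Prop :=
  ∀ G : SimpleGraph V,
    ((bipDist G : ℝ) ≤ a → 9 / 10 ≤ A.probOutput G {true}) ∧
    (b ≤ (bipDist G : ℝ) → 9 / 10 ≤ A.probOutput G {false})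

end RandQueryAlg

/-- The bound `C * x ^ 6 * log (1 + x) ^ m`; "`Õ(x ^ 6)`" means such a bound for some constants
`C` and `m`. (`1 + x` keeps the logarithm positive for all `x > 0`.) -/
noncomputable def softSixth (C : ℝ) (m : ℕ) (x : ℝ) : ℝ :=
  C * x ^ 6 * Real.log (1 + x) ^ m

/-! With `x = ±1` encoding the sides, the indicator that an edge is monochromatic is `(1 + x u * x
v) / 2`. So `bipDist` is `n ^ 2 / 2` times the edge density plus the minimum `q` of the normalized
quadratic form `avgForm` over signs, and it suffices to estimate this sum to within `2 * ε`.

Given a guess `b` for the vector `A x`, replace the form by the convex objective `⟨b, y⟩ + ‖A y -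
b‖₁` (normalized). It is at least `⟨y, A y⟩ ≥ q` for every `y` in the cube, and equals the form at
`x` when `y = x` and `b = A x`. By minimax, the bound `q` has a dual witness `z`
(`exists_dual_certificate`).

The algorithm samples a seed `S` of `r` vertices and `K` independent blocks of `r` rows and `r`
columns, with `r` and `K` of order `1 / ε ^ 2`. A sign pattern on `S` determines `b`, and the
sampled objective is minimized over all sign patterns on seed and columns. Restricting an optimal
`x` to the sample bounds the minimum from above (`card_lt_sampleMin_le`). From below, `z` depends
only on the seed and its pattern, and weak duality on each block bounds the objective uniformly in
the column signs. Hence only the `2 ^ r` seed patterns need a union bound; each fails with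
probability `exp (-Ω(K * ε ^ 2 * r))` by bounded differences and independence of the blocks
(`card_sampleMin_lt_le`). The `3 * K * r ^ 2` queries are `O(1 / ε ^ 6)`, without logarithms. -/

open Finset Function
open scoped BigOperators

/-! ### Concentration for uniform averages over finite products -/

/-- The average of a function of one coordinate over a power of a finite type. -/
theorem expect_pi_eval {ι V : Type*} [Fintype ι] [DecidableEq ι] [Fintype V] [Nonempty V]
    (i : ι) (H : V → ℝ) : 𝔼 x : ι → V, H (x i) = 𝔼 v, H v := by
  rw [Fintype.expect_equiv (Equiv.funSplitAt i V) (fun x => H (x i)) (fun p => H p.1)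
    (fun x => by simp), ← univ_product_univ, expect_product]
  simp

theorem expect_fin_cons {V : Type*} [Fintype V] {N : ℕ} (F : (Fin (N + 1) → V) → ℝ) :
    𝔼 x, F x = 𝔼 v : V, 𝔼 x : Fin N → V, F (Fin.cons v x) := by
  rw [← expect_product', univ_product_univ]
  exact (Fintype.expect_equiv (Fin.consEquiv fun _ => V) _ _ (fun _ => rfl)).symm

theorem exp_expect_le {V : Type*} [Fintype V] [Nonempty V] (G : V → ℝ) :
    Real.exp (𝔼 v, G v) ≤ 𝔼 v, Real.exp (G v) := by
  set μ := 𝔼 v, G v with hμ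
  -- Jensen's inequality from the tangent line of `exp` at the mean.
  have h : ∀ v ∈ (univ : Finset V), Real.exp μ * (G v - μ + 1) ≤ Real.exp (G v) := fun v _ => by
    have := Real.add_one_le_exp (G v - μ)
    calc _ ≤ Real.exp μ * Real.exp (G v - μ) := by gcongr
      _ = _ := by rw [← Real.exp_add]; ring_nf
  refine le_trans ?_ (expect_le_expect h)
  rw [← mul_expect, expect_add_distrib, expect_sub_distrib, ← hμ]
  simp

/-- A form of Hoeffding's lemma for a function on a finite set with oscillation at most `c`. -/
theorem expect_exp_le {V : Type*} [Fintype V] [Nonempty V] {G : V → ℝ} {c : ℝ}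
    (h : ∀ v w, |G v - G w| ≤ c) :
    𝔼 v, Real.exp (G v) ≤ Real.exp (𝔼 v, G v + c ^ 2 / 2) := by
  -- Symmetrization: Jensen introduces an independent copy `w`. The difference `G v - G w` is
  -- symmetric, so `exp` may be replaced by `cosh`, which is at most `exp (t ^ 2 / 2)`.
  have h1 : (𝔼 v, Real.exp (G v)) * Real.exp (-𝔼 v, G v) ≤
      𝔼 v, 𝔼 w, Real.exp (G v - G w) := by
    have := exp_expect_le fun v => -G v
    rw [expect_neg_distrib] at this
    refine (mul_le_mul_of_nonneg_left this (expect_nonneg fun v _ => (Real.exp_pos _).le)).trans ?_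
    rw [expect_mul_expect]
    simp_rw [← Real.exp_add, sub_eq_add_neg]
    rfl
  have h2 : 𝔼 v, 𝔼 w, Real.exp (G v - G w) ≤ Real.exp (c ^ 2 / 2) := by
    have hsymm : 𝔼 v, 𝔼 w, Real.exp (G v - G w) = 𝔼 v, 𝔼 w, Real.cosh (G v - G w) := by
      have hc : 𝔼 v, 𝔼 w, Real.exp (G v - G w) = 𝔼 v, 𝔼 w, Real.exp (-(G v - G w)) := by
        rw [expect_comm]; simp
      simp_rw [Real.cosh_eq, ← expect_div, expect_add_distrib]
      linarith
    rw [hsymm]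
    refine expect_le univ_nonempty fun v _ => expect_le univ_nonempty fun w _ => ?_
    refine (Real.cosh_le_exp_half_sq _).trans (Real.exp_le_exp.2 ?_)
    have := sq_le_sq' (neg_le_of_abs_le (h v w)) (le_of_abs_le (h v w))
    linarith
  have h3 := mul_le_mul_of_nonneg_right (h1.trans h2) (Real.exp_pos (𝔼 v, G v)).le
  rw [mul_assoc, ← Real.exp_add, ← Real.exp_add] at h3
  simpa [add_comm] using h3

/-- McDiarmid's inequality, at the level of moment generating functions. -/
theorem expect_exp_le_of_bounded_differences {V : Type*} [Fintype V] [Nonempty V] {N : ℕ}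
    {F : (Fin N → V) → ℝ} {c : ℝ} (hF : ∀ x i v, |F x - F (update x i v)| ≤ c) :
    𝔼 x, Real.exp (F x) ≤ Real.exp (𝔼 x, F x + N * c ^ 2 / 2) := by
  induction N with
  | zero => simp
  | succ N ih =>
    rw [expect_fin_cons, expect_fin_cons F]
    have h1 : ∀ v, 𝔼 x, Real.exp (F (Fin.cons v x)) ≤
        Real.exp (𝔼 x : Fin N → V, F (Fin.cons v x) + N * c ^ 2 / 2) := fun v => by
      refine ih fun x i w => ?_
      rw [Fin.cons_update]
      exact hF _ _ _
    refine (expect_le_expect fun v _ => h1 v).trans ?_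
    -- Averaging out the other coordinates leaves a function of the first one with oscillation at
    -- most `c`.
    have h2 : ∀ v w, |(𝔼 x : Fin N → V, F (Fin.cons v x) + N * c ^ 2 / 2) -
        (𝔼 x : Fin N → V, F (Fin.cons w x) + N * c ^ 2 / 2)| ≤ c := fun v w => by
      rw [add_sub_add_right_eq_sub, ← expect_sub_distrib]
      refine (abs_expect_le _ _).trans (expect_le univ_nonempty fun x _ => ?_)
      have := hF (Fin.cons v x) 0 w
      rwa [Fin.update_cons_zero] at this
    refine (expect_exp_le h2).trans (Real.exp_le_exp.2 ?_)
    rw [expect_add_distrib, Fintype.expect_const]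
    push_cast
    linarith

theorem expect_sum_sq {V : Type*} [Fintype V] [Nonempty V] {h : V → ℝ}
    (hh : 𝔼 v, h v = 0) (N : ℕ) :
    𝔼 x : Fin N → V, (∑ i, h (x i)) ^ 2 = N * 𝔼 v, h v ^ 2 := by
  induction N with
  | zero => simp
  | succ N ih =>
    rw [expect_fin_cons]
    simp only [Fin.sum_univ_succ, Fin.cons_zero, Fin.cons_succ, add_sq, expect_add_distrib,
      Fintype.expect_const, ih]
    -- The cross term vanishes: the new coordinate is independent of the others and `h` is centred.
    have : 𝔼 v : V, 𝔼 x : Fin N → V, 2 * h v * ∑ i, h (x i) = 0 := by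
      simp_rw [← mul_expect, ← expect_mul, ← mul_expect, hh]
      simp
    rw [this]
    push_cast
    ring

theorem sq_expect_le {ι : Type*} [Fintype ι] [Nonempty ι] (f : ι → ℝ) :
    (𝔼 i, f i) ^ 2 ≤ 𝔼 i, f i ^ 2 := by
  simpa [Fintype.expect_const] using expect_mul_sq_le_sq_mul_sq univ f fun _ => (1 : ℝ)

/-- The mean deviation of the average of `r` independent samples. -/
theorem expect_abs_expect_sub_le {V : Type*} [Fintype V] [Nonempty V] {h : V → ℝ}
    (hh : ∀ v, |h v| ≤ 1) {r : ℕ} (hr : 0 < r) :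
    𝔼 x : Fin r → V, |𝔼 i, h (x i) - 𝔼 v, h v| ≤ 1 / √r := by
  set μ := 𝔼 v, h v with hμ
  have : Nonempty (Fin r) := ⟨⟨0, hr⟩⟩
  have hr' : (0 : ℝ) < r := by exact_mod_cast hr
  have h0 : 𝔼 v, (h v - μ) = 0 := by
    rw [expect_sub_distrib, Fintype.expect_const, sub_self]
  have hvar : 𝔼 v, (h v - μ) ^ 2 ≤ 1 := by
    have e : 𝔼 v, (h v - μ) ^ 2 = 𝔼 v, h v ^ 2 - μ ^ 2 := by
      simp_rw [sub_sq]
      rw [expect_add_distrib, expect_sub_distrib, ← expect_mul, ← mul_expect, ← hμ,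
        Fintype.expect_const]
      ring
    have : 𝔼 v, h v ^ 2 ≤ 1 := expect_le univ_nonempty fun v _ => by
      rw [← sq_abs]; exact pow_le_one₀ (abs_nonneg _) (hh v)
    nlinarith [sq_nonneg μ]
  have key := expect_sum_sq h0 r
  have e : ∀ x : Fin r → V, |𝔼 i, h (x i) - μ| ^ 2 = (∑ i, (h (x i) - μ)) ^ 2 / r ^ 2 := fun x => by
    rw [sq_abs, Fintype.expect_eq_sum_div_card, ← div_pow]
    congr 1
    simp
    field_simp
  have h2 : (𝔼 x : Fin r → V, |𝔼 i, h (x i) - μ|) ^ 2 ≤ 1 / r := by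
    refine (sq_expect_le _).trans ?_
    simp_rw [e, ← expect_div, key]
    rw [div_le_div_iff₀ (by positivity) hr']
    nlinarith
  rw [← Real.sqrt_one, ← Real.sqrt_div zero_le_one]
  exact Real.le_sqrt_of_sq_le h2

/-- Markov's inequality for the uniform distribution. -/
theorem card_filter_le_of_expect {Ω : Type*} [Fintype Ω] (f : Ω → ℝ) (hf : ∀ ω, 0 ≤ f ω)
    {s δ : ℝ} (hs : 0 < s) (h : 𝔼 ω, f ω ≤ δ * s) :
    ((univ.filter fun ω => s ≤ f ω).card : ℝ) ≤ δ * Fintype.card Ω := by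
  rcases isEmpty_or_nonempty Ω with hΩ | hΩ
  · simp
  have hc : (0 : ℝ) < Fintype.card Ω := by exact_mod_cast Fintype.card_pos
  rw [Fintype.expect_eq_sum_div_card, div_le_iff₀ hc] at h
  have : (univ.filter fun ω => s ≤ f ω).card • s ≤ ∑ ω ∈ univ.filter fun ω => s ≤ f ω, f ω :=
    card_nsmul_le_sum _ _ _ fun ω hω => (mem_filter.1 hω).2
  have h2 : ∑ ω ∈ univ.filter (fun ω => s ≤ f ω), f ω ≤ ∑ ω, f ω :=
    sum_le_sum_of_subset_of_nonneg (filter_subset _ _) fun ω _ _ => hf ω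
  rw [nsmul_eq_mul] at this
  nlinarith

/-! ### Quadratic forms on the cube and duality -/

/-- The sign `1` or `-1` encoded by a Boolean. -/
def boolSign (b : Bool) : ℝ := if b then 1 else -1

theorem abs_boolSign (b : Bool) : |boolSign b| = 1 := by
  cases b <;> simp [boolSign]

/-- The normalized quadratic form of a matrix. -/
noncomputable def avgForm {V : Type*} [Fintype V] (A : V → V → ℝ) (x : V → ℝ) : ℝ :=
  𝔼 u, 𝔼 v, A u v * x u * x v

/-- With zero diagonal no square of a variable occurs, so the form is affine in each coordinate
separately. -/
theorem exists_affine_avgForm_update {V : Type*} [Fintype V] [DecidableEq V] {A : V → V → ℝ}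
    (hA : ∀ v, A v v = 0) (x : V → ℝ) (v : V) :
    ∃ α β : ℝ, ∀ t, avgForm A (update x v t) = α + β * t := by
  have h : ∀ u w, ∃ α β : ℝ, ∀ t, A u w * update x v t u * update x v t w = α + β * t := by
    intro u w
    by_cases hu : u = v
    · by_cases hw : w = v
      · exact ⟨0, 0, fun t => by simp [hu, hw, hA]⟩
      · exact ⟨0, A u w * x w, fun t => by subst hu; simp [hw]; ring⟩
    · by_cases hw : w = v
      · exact ⟨0, A u w * x u, fun t => by subst hw; simp [hu]⟩
      · exact ⟨A u w * x u * x w, 0, fun t => by simp [hu, hw]⟩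
  choose α β h using h
  refine ⟨𝔼 u, 𝔼 w, α u w, 𝔼 u, 𝔼 w, β u w, fun t => ?_⟩
  simp_rw [avgForm, h, expect_add_distrib, expect_mul]

/-- A quadratic form with zero diagonal attains its minimum over the cube at a vertex. -/
theorem exists_sign_avgForm_le {V : Type*} [Fintype V] {A : V → V → ℝ}
    (hA : ∀ v, A v v = 0) (x : V → ℝ) (hx : ∀ v, |x v| ≤ 1) :
    ∃ f : V → Bool, avgForm A (fun v => boolSign (f v)) ≤ avgForm A x := by
  classical
  -- Coordinates are moved to an endpoint one at a time; an affine function does not increase in at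
  -- least one direction.
  have key : ∀ s : Finset V, ∃ y : V → ℝ, (∀ v, |y v| ≤ 1) ∧ (∀ v ∈ s, y v = 1 ∨ y v = -1) ∧
      avgForm A y ≤ avgForm A x := by
    intro s
    induction s using Finset.induction_on with
    | empty => exact ⟨x, hx, by simp, le_rfl⟩
    | insert v s hv ih =>
      obtain ⟨y, hy1, hys, hyx⟩ := ih
      obtain ⟨α, β, hαβ⟩ := exists_affine_avgForm_update hA y v
      have hy := hαβ (y v)
      rw [update_eq_self] at hy
      have hyv := abs_le.1 (hy1 v)
      obtain ⟨t, ht, hle⟩ : ∃ t : ℝ, (t = 1 ∨ t = -1) ∧ α + β * t ≤ α + β * y v := by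
        rcases le_total 0 β with hβ | hβ
        · exact ⟨-1, Or.inr rfl, by nlinarith⟩
        · exact ⟨1, Or.inl rfl, by nlinarith⟩
      refine ⟨update y v t, fun w => ?_, fun w hw => ?_, by rw [hαβ]; linarith⟩
      · by_cases hwv : w = v
        · subst hwv; rcases ht with rfl | rfl <;> simp
        · simpa [hwv] using hy1 w
      · by_cases hwv : w = v
        · subst hwv; simpa using ht
        · simpa [hwv] using hys w ((mem_insert.1 hw).resolve_left hwv)
  obtain ⟨y, -, hy, hyx⟩ := key univ
  refine ⟨fun v => decide (y v = 1), le_of_eq_of_le ?_ hyx⟩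
  congr 1
  funext v
  rcases hy v (mem_univ v) with h | h <;> simp [boolSign, h]
  norm_num

/-- Linearize the form `x ↦ 𝔼 u, 𝔼 v, A u v * x u * x v` at an arbitrary guess `b` for `A x`,
with an `ℓ¹` penalty for a wrong guess. This is the dual certificate for the resulting convex
program: its value is at least the minimum of the form over signs. -/
theorem exists_dual_certificate {V : Type*} [Fintype V] {A : V → V → ℝ}
    (hA : ∀ v, A v v = 0) {q : ℝ} (hq : ∀ f : V → Bool, q ≤ avgForm A (fun v => boolSign (f v)))
    (b : V → ℝ) :
    ∃ z : V → ℝ, (∀ v, |z v| ≤ 1) ∧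
      q ≤ -(𝔼 v, |b v + 𝔼 u, A u v * z u|) - 𝔼 u, z u * b u := by
  -- The multiplier `z` in the cube encodes the `ℓ¹` penalty: maximizing over `z` gives `‖A y -
  -- b‖₁`.
  let F : (V → ℝ) → (V → ℝ) → ℝ := fun y z =>
    𝔼 v, b v * y v + 𝔼 u, z u * (𝔼 v, A u v * y v - b u)
  let X : Set (V → ℝ) := Set.Icc (fun _ => -1) fun _ => 1
  have hX : ∀ y, y ∈ X ↔ ∀ v, |y v| ≤ 1 := fun y => by
    simp [X, Set.mem_Icc, Pi.le_def, abs_le, forall_and]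
  have hne : X.Nonempty := ⟨0, (hX _).2 fun v => by simp⟩
  have hconv : Convex ℝ X := convex_Icc _ _
  have hcpt : IsCompact X := isCompact_Icc
  have hc1 : ∀ z, Continuous fun y => F y z := fun z => by
    simp only [F, Fintype.expect_eq_sum_div_card]
    fun_prop
  have hc2 : ∀ y, Continuous fun z => F y z := fun y => by
    simp only [F, Fintype.expect_eq_sum_div_card]
    fun_prop
  have hF : ∀ y z, F y z = 𝔼 u, (b u * y u + z u * (𝔼 v, A u v * y v - b u)) := fun y z => by
    rw [expect_add_distrib]
  have ha1 : ∀ z y y' s t, s + t = 1 → F (s • y + t • y') z = s * F y z + t * F y' z := by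
    intro z y y' s t hst
    rw [hF, hF, hF, mul_expect, mul_expect, ← expect_add_distrib]
    refine expect_congr rfl fun u _ => ?_
    have : 𝔼 v, A u v * (s • y + t • y') v = s * 𝔼 v, A u v * y v + t * 𝔼 v, A u v * y' v := by
      rw [mul_expect, mul_expect, ← expect_add_distrib]
      exact expect_congr rfl fun v _ => by simp; ring
    rw [this]
    simp only [Pi.add_apply, Pi.smul_apply, smul_eq_mul]
    linear_combination (z u * b u) * hst
  have ha2 : ∀ y z z' s t, s + t = 1 → F y (s • z + t • z') = s * F y z + t * F y z' := by
    intro y z z' s t hst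
    rw [hF, hF, hF, mul_expect, mul_expect, ← expect_add_distrib]
    refine expect_congr rfl fun u _ => ?_
    simp only [Pi.add_apply, Pi.smul_apply, smul_eq_mul]
    linear_combination (-(b u * y u)) * hst
  obtain ⟨a, ha, z, hz, h⟩ := Sion.exists_isSaddlePointOn' hne hcpt
    (f := F) (Y := X) (fun z _ => (hc1 z).lowerSemicontinuous.lowerSemicontinuousOn _)
    (fun z _ => ConvexOn.quasiconvexOn ⟨hconv, fun y _ y' _ s t _ _ hst => (ha1 z y y' s t hst).le⟩)
    hconv hcpt (fun y _ => (hc2 y).upperSemicontinuous.upperSemicontinuousOn _)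
    (fun y _ => ConcaveOn.quasiconcaveOn
      ⟨hconv, fun z _ z' _ s t _ _ hst => (ha2 y z z' s t hst).ge⟩) hconv hne
  refine ⟨z, (hX z).1 hz, ?_⟩
  -- Taking the multiplier equal to `a` cancels `b` and leaves the form at `a`.
  have hqa : q ≤ F a a := by
    obtain ⟨f, hf⟩ := exists_sign_avgForm_le hA a ((hX a).1 ha)
    refine (hq f).trans (hf.trans (le_of_eq ?_))
    simp only [F, avgForm, ← expect_add_distrib]
    refine expect_congr rfl fun u _ => ?_
    rw [mul_sub, mul_expect]
    have : ∀ v, A u v * a u * a v = a u * (A u v * a v) := fun v => by ring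
    simp_rw [this]
    ring
  -- The minimizer of `F · z` takes the sign opposite to its coefficient, producing minus the `ℓ¹`
  -- norm.
  let y : V → ℝ := fun v => if 0 ≤ b v + 𝔼 u, A u v * z u then -1 else 1
  have hy : y ∈ X := (hX y).2 fun v => by simp only [y]; split_ifs <;> simp
  refine hqa.trans ((h y hy a ha).trans (le_of_eq ?_))
  have e1 : 𝔼 u, z u * (𝔼 v, A u v * y v - b u) =
      𝔼 v, y v * (𝔼 u, A u v * z u) - 𝔼 u, z u * b u := by
    simp_rw [mul_sub, expect_sub_distrib, mul_expect]
    rw [expect_comm]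
    congr 1
    refine expect_congr rfl fun u _ => expect_congr rfl fun v _ => by ring
  have e2 : ∀ v, |b v + 𝔼 u, A u v * z u| = -(y v * (b v + 𝔼 u, A u v * z u)) := fun v => by
    simp only [y]
    split_ifs with h0
    · rw [abs_of_nonneg h0]; ring
    · rw [abs_of_neg (not_le.1 h0)]; ring
  simp only [F, e1]
  simp_rw [e2, mul_add, expect_neg_distrib, expect_add_distrib, mul_comm (b _)]
  ring

/-! ### Nonadaptive algorithms as decision trees -/

namespace AdjQueryTree

variable {V α : Type}

/-- Any function of the answers to `N` fixed queries is computed by a tree of depth at most `N`. -/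
theorem exists_run_eq_of_fin {N : ℕ} (e : Fin N → V × V) (Φ : (Fin N → Prop) → α) :
    ∃ T : AdjQueryTree V α, T.depth ≤ N ∧
      ∀ G : SimpleGraph V, T.run G = Φ fun i => G.Adj (e i).1 (e i).2 := by
  classical
  induction N with
  | zero =>
    refine ⟨output (Φ Fin.elim0), by simp [depth], fun G => ?_⟩
    rw [run]
    congr 1
    exact Subsingleton.elim _ _
  | succ N ih =>
    choose T hT hrun using fun b : Bool =>
      ih (fun i => e i.succ) fun p => Φ (Fin.cons (b = true) p)
    refine ⟨query (e 0).1 (e 0).2 T, ?_, fun G => ?_⟩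
    · have h0 := hT false
      have h1 := hT true
      simp only [depth]
      omega
    · rw [run, hrun]
      congr 1
      funext i
      refine Fin.cases ?_ (fun i => ?_) i
      · simp
      · simp

/-- A function of the graph that depends only on the adjacencies of the pairs `e i` is computed by
a tree that queries these pairs. -/
theorem exists_run_eq {ι : Type*} [Fintype ι] (e : ι → V × V) (F : SimpleGraph V → α)
    (hF : ∀ G G' : SimpleGraph V,
      (∀ i, G.Adj (e i).1 (e i).2 ↔ G'.Adj (e i).1 (e i).2) → F G = F G') :
    ∃ T : AdjQueryTree V α, T.depth ≤ Fintype.card ι ∧ ∀ G, T.run G = F G := by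
  let eq := (Fintype.equivFin ι).symm
  let ans : SimpleGraph V → Fin (Fintype.card ι) → Prop :=
    fun G i => G.Adj (e (eq i)).1 (e (eq i)).2
  have hfac : F.FactorsThrough ans := fun G G' h => hF G G' fun i => by
    have := congrFun h (eq.symm i)
    simpa [ans] using this
  -- Answer patterns realized by no graph receive the irrelevant default `F ⊥`.
  obtain ⟨T, hT, hrun⟩ := exists_run_eq_of_fin (fun i => e (eq i))
    (Function.extend ans F fun _ => F ⊥)
  exact ⟨T, hT, fun G => (hrun G).trans (hfac.extend_apply _ G)⟩

/-- Post-processing of the output. -/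
def mapOutput {β : Type} (φ : α → β) : AdjQueryTree V α → AdjQueryTree V β
  | output a => output (φ a)
  | query u v next => query u v fun b => (next b).mapOutput φ

theorem depth_mapOutput {β : Type} (φ : α → β) (T : AdjQueryTree V α) :
    (T.mapOutput φ).depth = T.depth := by
  induction T with
  | output a => rfl
  | query u v next ih => simp [mapOutput, depth, ih]

theorem run_mapOutput {β : Type} (φ : α → β) (T : AdjQueryTree V α) (G : SimpleGraph V) :
    (T.mapOutput φ).run G = φ (T.run G) := by
  induction T with
  | output a => rfl
  | query u v next ih => simp only [mapOutput, run, ih]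

end AdjQueryTree

namespace RandQueryAlg

variable {V α : Type}

/-- Post-processing of the output of a randomized algorithm. -/
noncomputable def mapOutput {β : Type} (φ : α → β) (A : RandQueryAlg V α) : RandQueryAlg V β :=
  PMF.map (AdjQueryTree.mapOutput φ) A

theorem QueriesAtMost.mapOutput {β : Type} (φ : α → β) {A : RandQueryAlg V α} {q : ℝ}
    (h : A.QueriesAtMost q) : (A.mapOutput φ).QueriesAtMost q := by
  intro T hT
  rw [RandQueryAlg.mapOutput, PMF.mem_support_map_iff] at hT
  obtain ⟨T, hT, rfl⟩ := hT
  rw [AdjQueryTree.depth_mapOutput]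
  exact h T hT

theorem probOutput_mapOutput {β : Type} (φ : α → β) (A : RandQueryAlg V α) (G : SimpleGraph V)
    (S : Set β) : (A.mapOutput φ).probOutput G S = A.probOutput G (φ ⁻¹' S) := by
  rw [probOutput, mapOutput, PMF.toOuterMeasure_map_apply, probOutput]
  congr 1
  ext T
  simp [AdjQueryTree.run_mapOutput]

theorem QueriesAtMost.mono {A : RandQueryAlg V α} {q q' : ℝ} (h : A.QueriesAtMost q)
    (hq : q ≤ q') : A.QueriesAtMost q' := fun T hT => (h T hT).trans hq

theorem probOutput_mono {A : RandQueryAlg V α} {G : SimpleGraph V} {S S' : Set α} (h : S ⊆ S') :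
    A.probOutput G S ≤ A.probOutput G S' :=
  MeasureTheory.measure_mono fun _ hT => h hT

theorem queriesAtMost_pure_output (a : α) {q : ℝ} (hq : 0 ≤ q) :
    QueriesAtMost (PMF.pure (AdjQueryTree.output a) : RandQueryAlg V α) q := by
  intro T hT
  rw [PMF.mem_support_pure_iff] at hT
  subst hT
  simpa [AdjQueryTree.depth] using hq

theorem probOutput_pure_output {a : α} {S : Set α} (ha : a ∈ S) (G : SimpleGraph V) :
    9 / 10 ≤ probOutput (PMF.pure (AdjQueryTree.output a) : RandQueryAlg V α) G S := by
  rw [probOutput, PMF.toOuterMeasure_pure_apply,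
    if_pos (show _ ∈ {T : AdjQueryTree V α | T.run G ∈ S} from ha)]
  exact ENNReal.div_le_of_le_mul (by norm_num)

/-- The uniform mixture of nonadaptive algorithms indexed by a finite sample space. -/
theorem exists_of_uniform {Ω ι : Type} [Fintype Ω] [Nonempty Ω] [Fintype ι] (e : Ω → ι → V × V)
    (F : Ω → SimpleGraph V → α)
    (hF : ∀ ω, ∀ G G' : SimpleGraph V,
      (∀ i, G.Adj (e ω i).1 (e ω i).2 ↔ G'.Adj (e ω i).1 (e ω i).2) → F ω G = F ω G') :
    ∃ A : RandQueryAlg V α, A.QueriesAtMost (Fintype.card ι) ∧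
      ∀ (G : SimpleGraph V) (S : Set α) (B : Finset Ω), (∀ ω ∉ B, F ω G ∈ S) →
        (B.card : ℝ) ≤ 1 / 10 * Fintype.card Ω → 9 / 10 ≤ A.probOutput G S := by
  classical
  choose T hT hrun using fun ω => AdjQueryTree.exists_run_eq (e ω) (F ω) (hF ω)
  refine ⟨PMF.map T (PMF.uniformOfFintype Ω), fun T' hT' => ?_, fun G S B hB hcard => ?_⟩
  · rw [PMF.mem_support_map_iff] at hT'
    obtain ⟨ω, -, rfl⟩ := hT'
    exact_mod_cast hT ω
  · rw [probOutput, PMF.toOuterMeasure_map_apply]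
    refine le_trans ?_ (MeasureTheory.measure_mono
      (show ((Bᶜ : Finset Ω) : Set Ω) ⊆ T ⁻¹' {T | T.run G ∈ S} from fun ω hω => ?_))
    · rw [PMF.toOuterMeasure_uniformOfFintype_apply]
      have hpos : 0 < Fintype.card Ω := Fintype.card_pos
      rw [ENNReal.le_div_iff_mul_le (by simp) (by simp), ENNReal.mul_comm_div,
        ← mul_div_assoc, ENNReal.div_le_iff_le_mul (by simp) (by simp)]
      have h1 : B.card + (Bᶜ : Finset Ω).card = Fintype.card Ω := card_add_card_compl B
      have h2 : 10 * B.card ≤ Fintype.card Ω := by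
        have : (10 * B.card : ℝ) ≤ Fintype.card Ω := by linarith
        exact_mod_cast this
      simp only [Fintype.card_coe, coe_sort_coe]
      have h3 : 9 * Fintype.card Ω ≤ (Bᶜ : Finset Ω).card * 10 := by omega
      exact_mod_cast h3
    · simp only [Set.mem_preimage, Set.mem_ofPred_eq, hrun]
      exact hB ω (by simpa using hω)

end RandQueryAlg

/-! ### The bipartite distance as a quadratic minimum -/

open Classical in
/-- The adjacency matrix with real entries. -/
noncomputable def adjIndicator {V : Type*} (G : SimpleGraph V) (u v : V) : ℝ :=
  if G.Adj u v then 1 else 0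

theorem adjIndicator_self {V : Type*} (G : SimpleGraph V) (v : V) : adjIndicator G v v = 0 := by
  simp [adjIndicator]

theorem abs_adjIndicator_le {V : Type*} (G : SimpleGraph V) (u v : V) :
    |adjIndicator G u v| ≤ 1 := by
  unfold adjIndicator; split_ifs <;> simp

theorem bipDistWith_eq {V : Type} [Fintype V] [Nonempty V] (G : SimpleGraph V) (f : V → Bool) :
    (bipDistWith G f : ℝ) = (Fintype.card V : ℝ) ^ 2 / 2 *
      (𝔼 u, 𝔼 v, adjIndicator G u v + avgForm (adjIndicator G) fun v => boolSign (f v)) := by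
  classical
  have h1 : bipDistWith G f = ∑ v, (G.neighborSet v ∩ f ⁻¹' {f v}).ncard := by
    rw [bipDistWith, ← sum_filter_add_sum_filter_not univ (fun v => f v = false)]
    congr 1
    · refine sum_congr rfl fun v hv => ?_
      rw [(mem_filter.1 hv).2]
    · simp only [Bool.not_eq_false]
      refine sum_congr rfl fun v hv => ?_
      rw [(mem_filter.1 hv).2]
  have h2 : ∀ v, ((G.neighborSet v ∩ f ⁻¹' {f v}).ncard : ℝ) =
      ∑ w, (adjIndicator G v w + adjIndicator G v w * boolSign (f v) * boolSign (f w)) / 2 := by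
    intro v
    have : G.neighborSet v ∩ f ⁻¹' {f v} =
        ((univ.filter fun w => G.Adj v w ∧ f w = f v : Finset V) : Set V) := by
      ext w; simp
    rw [this, Set.ncard_coe_finset, card_filter]
    push_cast
    refine sum_congr rfl fun w _ => ?_
    by_cases h : G.Adj v w <;> cases hv : f v <;> cases hw : f w <;>
      simp [adjIndicator, boolSign, h]
  have hV : (Fintype.card V : ℝ) ≠ 0 := by exact_mod_cast Fintype.card_ne_zero
  rw [h1, avgForm]
  push_cast
  simp_rw [h2, ← expect_add_distrib, Fintype.expect_eq_sum_div_card, ← sum_div]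
  field_simp

/-- The minimum over bipartitions of the quadratic form determines the bipartite distance. -/
theorem exists_bipDist_eq {V : Type} [Fintype V] [Nonempty V] (G : SimpleGraph V) :
    ∃ f₀ : V → Bool,
      (∀ f : V → Bool, avgForm (adjIndicator G) (fun v => boolSign (f₀ v)) ≤
        avgForm (adjIndicator G) fun v => boolSign (f v)) ∧
      (bipDist G : ℝ) = (Fintype.card V : ℝ) ^ 2 / 2 *
        (𝔼 u, 𝔼 v, adjIndicator G u v +
          avgForm (adjIndicator G) fun v => boolSign (f₀ v)) := by
  obtain ⟨f₀, hf₀⟩ := exists_eq_ciInf_of_finite (f := fun f : V → Bool => bipDistWith G f)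
  refine ⟨f₀, fun f => ?_, by rw [bipDist, ← hf₀, bipDistWith_eq]⟩
  have h : bipDistWith G f₀ ≤ bipDistWith G f := hf₀.le.trans (ciInf_le (OrderBot.bddBelow _) f)
  have h' : (bipDistWith G f₀ : ℝ) ≤ bipDistWith G f := by exact_mod_cast h
  have hV : (0 : ℝ) < Fintype.card V := by exact_mod_cast Fintype.card_pos
  rw [bipDistWith_eq, bipDistWith_eq] at h'
  have := le_of_mul_le_mul_left h' (by positivity)
  linarith

theorem bipDist_le {V : Type} [Fintype V] (G : SimpleGraph V) :
    bipDist G ≤ Fintype.card V ^ 2 := by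
  classical
  refine (ciInf_le (OrderBot.bddBelow _) fun _ => false).trans ?_
  rw [bipDistWith]
  simp only [filter_true, Bool.false_eq_true, filter_false, sum_empty, add_zero]
  refine (sum_le_card_nsmul _ _ (Fintype.card V) fun v _ => ?_).trans (by simp [sq])
  exact (Set.ncard_le_card _).trans (by simp)

/-! ### Primal and dual values on a sampled block -/

theorem expect_expect_eval {V : Type*} [Fintype V] {r : ℕ} [Nonempty V] (hr : 0 < r) (h : V → ℝ) :
    𝔼 x : Fin r → V, 𝔼 j, h (x j) = 𝔼 v, h v := by
  have : Nonempty (Fin r) := ⟨⟨0, hr⟩⟩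
  rw [expect_comm]
  simp [expect_pi_eval]

/-- The linearized and penalized objective on a block of sampled rows `Z` and columns `Y`. -/
noncomputable def blockValue {V : Type*} {r : ℕ}
    (A : V → V → ℝ) (b : V → ℝ) (Z Y : Fin r → V) (y : Fin r → Bool) : ℝ :=
  𝔼 j, b (Y j) * boolSign (y j) + 𝔼 i, |𝔼 j, A (Z i) (Y j) * boolSign (y j) - b (Z i)| +
    𝔼 i, 𝔼 j, A (Z i) (Y j)

/-- The lower bound for `blockValue` given by a dual vector `z`. -/
noncomputable def blockDual {V : Type*} {r : ℕ}
    (A : V → V → ℝ) (b z : V → ℝ) (Z Y : Fin r → V) : ℝ :=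
  -(𝔼 j, |b (Y j) + 𝔼 i, A (Z i) (Y j) * z (Z i)|) - 𝔼 i, z (Z i) * b (Z i) +
    𝔼 i, 𝔼 j, A (Z i) (Y j)

/-- Weak duality on the sample: `z` tests the `ℓ¹` penalty, after which each column sign contributes
at least minus the absolute value of its coefficient. The bound does not involve `y`. -/
theorem blockDual_le_blockValue {V : Type*} {r : ℕ}
    (A : V → V → ℝ) (b : V → ℝ) {z : V → ℝ} (hz : ∀ v, |z v| ≤ 1)
    (Z Y : Fin r → V) (y : Fin r → Bool) : blockDual A b z Z Y ≤ blockValue A b Z Y y := by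
  have h1 : 𝔼 i, z (Z i) * (𝔼 j, A (Z i) (Y j) * boolSign (y j) - b (Z i)) ≤
      𝔼 i, |𝔼 j, A (Z i) (Y j) * boolSign (y j) - b (Z i)| :=
    expect_le_expect fun i _ => by
      refine (le_abs_self _).trans ?_
      rw [abs_mul]
      exact mul_le_of_le_one_left (abs_nonneg _) (hz _)
  have h2 : -(𝔼 j, |b (Y j) + 𝔼 i, A (Z i) (Y j) * z (Z i)|) ≤
      𝔼 j, boolSign (y j) * (b (Y j) + 𝔼 i, A (Z i) (Y j) * z (Z i)) := by
    rw [← expect_neg_distrib]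
    refine expect_le_expect fun j _ => ?_
    refine le_trans (le_of_eq ?_) (neg_abs_le _)
    rw [abs_mul, abs_boolSign, one_mul]
  have h3 : 𝔼 i, z (Z i) * (𝔼 j, A (Z i) (Y j) * boolSign (y j) - b (Z i)) =
      𝔼 j, boolSign (y j) * (𝔼 i, A (Z i) (Y j) * z (Z i)) - 𝔼 i, z (Z i) * b (Z i) := by
    simp_rw [mul_sub, expect_sub_distrib, mul_expect]
    rw [expect_comm]
    congr 1
    exact expect_congr rfl fun j _ => expect_congr rfl fun i _ => by ring
  have h4 : 𝔼 j, boolSign (y j) * (b (Y j) + 𝔼 i, A (Z i) (Y j) * z (Z i)) =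
      𝔼 j, b (Y j) * boolSign (y j) + 𝔼 j, boolSign (y j) * (𝔼 i, A (Z i) (Y j) * z (Z i)) := by
    rw [← expect_add_distrib]
    exact expect_congr rfl fun j _ => by ring
  rw [blockDual, blockValue]
  linarith

/-- Only the absolute value is biased: for a fixed column, replacing the row average by its sample
mean costs at most `1 / √r` on average. All other terms are unbiased. -/
theorem le_expect_blockDual {V : Type*} [Fintype V] {r : ℕ}
    [Nonempty V] {A : V → V → ℝ} (hA : ∀ u v, |A u v| ≤ 1) (b : V → ℝ)
    {z : V → ℝ} (hz : ∀ v, |z v| ≤ 1) (hr : 0 < r) :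
    -(𝔼 v, |b v + 𝔼 u, A u v * z u|) - 𝔼 u, z u * b u + 𝔼 u, 𝔼 v, A u v - 1 / √r ≤
      𝔼 Y : Fin r → V, 𝔼 Z : Fin r → V, blockDual A b z Z Y := by
  have : Nonempty (Fin r) := ⟨⟨0, hr⟩⟩
  have h1 : 𝔼 Y : Fin r → V, 𝔼 Z : Fin r → V, 𝔼 j, |b (Y j) + 𝔼 i, A (Z i) (Y j) * z (Z i)| ≤
      𝔼 v, |b v + 𝔼 u, A u v * z u| + 1 / √r := by
    have e : ∀ Y : Fin r → V,
        𝔼 Z : Fin r → V, 𝔼 j, |b (Y j) + 𝔼 i, A (Z i) (Y j) * z (Z i)| =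
        𝔼 j, 𝔼 Z : Fin r → V, |b (Y j) + 𝔼 i, A (Z i) (Y j) * z (Z i)| :=
      fun Y => expect_comm _ _ _
    simp_rw [e]
    rw [expect_expect_eval hr fun v => 𝔼 Z : Fin r → V, |b v + 𝔼 i, A (Z i) v * z (Z i)|,
      ← sub_le_iff_le_add', ← expect_sub_distrib]
    refine expect_le univ_nonempty fun v _ => ?_
    rw [sub_le_iff_le_add']
    have := expect_abs_expect_sub_le (h := fun u => A u v * z u)
      (fun u => by rw [abs_mul]; exact mul_le_one₀ (hA u v) (abs_nonneg _) (hz u)) hr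
    refine le_trans ?_ (add_le_add_right this _)
    rw [← sub_le_iff_le_add']
    conv_lhs => rw [← Fintype.expect_const (ι := Fin r → V) |b v + 𝔼 u, A u v * z u|]
    rw [← expect_sub_distrib]
    refine expect_le_expect fun Z _ => ?_
    refine (abs_sub_abs_le_abs_sub _ _).trans (le_of_eq ?_)
    congr 1
    ring
  have h2 : 𝔼 Y : Fin r → V, 𝔼 Z : Fin r → V, 𝔼 i, z (Z i) * b (Z i) = 𝔼 u, z u * b u := by
    rw [expect_expect_eval hr fun v => z v * b v, Fintype.expect_const]
  have h3 : 𝔼 Y : Fin r → V, 𝔼 Z : Fin r → V, 𝔼 i, 𝔼 j, A (Z i) (Y j) = 𝔼 u, 𝔼 v, A u v := by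
    have e : ∀ Y : Fin r → V, 𝔼 Z : Fin r → V, 𝔼 i, 𝔼 j, A (Z i) (Y j) =
        𝔼 j, 𝔼 u, A u (Y j) := fun Y => by
      rw [expect_expect_eval hr fun v => 𝔼 j, A v (Y j), expect_comm]
    simp_rw [e]
    rw [expect_expect_eval hr fun v => 𝔼 u, A u v, expect_comm]
  simp only [blockDual, expect_add_distrib, expect_sub_distrib, expect_neg_distrib]
  linarith

theorem abs_expect_sub_expect_le_of_eq_off {r : ℕ} {f g : Fin r → ℝ} {c : ℝ} (i : Fin r)
    (hne : ∀ j, j ≠ i → f j = g j) (hi : |f i - g i| ≤ c) :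
    |𝔼 j, f j - 𝔼 j, g j| ≤ c / r := by
  rw [← expect_sub_distrib, Fintype.expect_eq_sum_div_card, Fintype.card_fin, abs_div,
    Nat.abs_cast, sum_eq_single i (fun j _ hj => by rw [hne j hj, sub_self]) (by simp)]
  gcongr

theorem abs_sub_le_two {a b : ℝ} (ha : |a| ≤ 1) (hb : |b| ≤ 1) : |a - b| ≤ 2 := by
  have := abs_sub a b
  linarith

theorem abs_expect_le_one {r : ℕ}
    (hr : 0 < r) {f : Fin r → ℝ} (hf : ∀ i, |f i| ≤ 1) : |𝔼 i, f i| ≤ 1 := by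
  have : Nonempty (Fin r) := ⟨⟨0, hr⟩⟩
  exact (abs_expect_le _ _).trans (expect_le univ_nonempty fun i _ => hf i)

theorem abs_blockDual_sub_update_left {V : Type*} {r : ℕ}
    {A : V → V → ℝ} (hA : ∀ u v, |A u v| ≤ 1) {b z : V → ℝ}
    (hb : ∀ v, |b v| ≤ 1) (hz : ∀ v, |z v| ≤ 1) (Z Y : Fin r → V) (i : Fin r) (v : V) :
    |blockDual A b z Z Y - blockDual A b z (update Z i v) Y| ≤ 6 / r := by
  have hr : 0 < r := i.pos
  have : Nonempty (Fin r) := ⟨i⟩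
  have hAz : ∀ u w, |A u w * z u| ≤ 1 := fun u w => by
    rw [abs_mul]; exact mul_le_one₀ (hA u w) (abs_nonneg _) (hz u)
  have hzb : ∀ u, |z u * b u| ≤ 1 := fun u => by
    rw [abs_mul]; exact mul_le_one₀ (hz u) (abs_nonneg _) (hb u)
  have key : ∀ h : V → ℝ, (∀ u, |h u| ≤ 1) →
      |𝔼 l, h (Z l) - 𝔼 l, h (update Z i v l)| ≤ 2 / r := fun h hh =>
    abs_expect_sub_expect_le_of_eq_off i (fun j hj => by rw [update_of_ne hj])
      (abs_sub_le_two (hh _) (hh _))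
  have h1 : |𝔼 j, |b (Y j) + 𝔼 l, A (Z l) (Y j) * z (Z l)| -
      (𝔼 j, |b (Y j) + 𝔼 l, A (update Z i v l) (Y j) * z (update Z i v l)|)| ≤ 2 / r := by
    rw [← expect_sub_distrib]
    refine (abs_expect_le _ _).trans (expect_le univ_nonempty fun j _ => ?_)
    refine (abs_abs_sub_abs_le _ _).trans ?_
    rw [add_sub_add_left_eq_sub]
    exact key (fun u => A u (Y j) * z u) fun u => hAz u _
  have h2 := key (fun u => z u * b u) hzb
  have h3 := key (fun u => 𝔼 j, A u (Y j)) fun u => abs_expect_le_one hr fun j => hA u _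
  have e : (6 : ℝ) / r = 2 / r + 2 / r + 2 / r := by ring
  rw [abs_le] at h1 h2 h3 ⊢
  simp only [blockDual]
  constructor <;> linarith

theorem abs_blockDual_sub_update_right {V : Type*} {r : ℕ}
    {A : V → V → ℝ} (hA : ∀ u v, |A u v| ≤ 1) {b z : V → ℝ}
    (hb : ∀ v, |b v| ≤ 1) (hz : ∀ v, |z v| ≤ 1) (Z Y : Fin r → V) (i : Fin r) (v : V) :
    |blockDual A b z Z Y - blockDual A b z Z (update Y i v)| ≤ 6 / r := by
  have hr : 0 < r := i.pos
  have : Nonempty (Fin r) := ⟨i⟩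
  have hbz : ∀ w, |b w + 𝔼 l, A (Z l) w * z (Z l)| ≤ 2 := fun w => by
    have h1 : |𝔼 l, A (Z l) w * z (Z l)| ≤ 1 := abs_expect_le_one hr fun l => by
      rw [abs_mul]; exact mul_le_one₀ (hA _ _) (abs_nonneg _) (hz _)
    have := abs_add_le (b w) (𝔼 l, A (Z l) w * z (Z l))
    linarith [hb w]
  have h1 : |𝔼 j, |b (Y j) + 𝔼 l, A (Z l) (Y j) * z (Z l)| -
      (𝔼 j, |b (update Y i v j) + 𝔼 l, A (Z l) (update Y i v j) * z (Z l)|)| ≤ 4 / r :=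
    abs_expect_sub_expect_le_of_eq_off i (fun j hj => by rw [update_of_ne hj]) (by
      refine (abs_sub _ _).trans ?_
      rw [abs_abs, abs_abs]
      linarith [hbz (Y i), hbz (update Y i v i)])
  have h3 : |𝔼 l, 𝔼 j, A (Z l) (Y j) - 𝔼 l, 𝔼 j, A (Z l) (update Y i v j)| ≤ 2 / r := by
    rw [← expect_sub_distrib]
    refine (abs_expect_le _ _).trans (expect_le univ_nonempty fun l _ => ?_)
    exact abs_expect_sub_expect_le_of_eq_off i (fun j hj => by rw [update_of_ne hj])
      (abs_sub_le_two (hA _ _) (hA _ _))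
  have e : (6 : ℝ) / r = 4 / r + 2 / r := by ring
  rw [abs_le] at h1 h3 ⊢
  simp only [blockDual]
  constructor <;> linarith

/-- Bounded differences are applied to the rows `Z` for fixed `Y`, then to the columns of the
`Z`-average. Each application contributes `r * (6 * θ / r) ^ 2 / 2 = 18 * θ ^ 2 / r`. -/
theorem expect_exp_blockDual_le {V : Type*} [Fintype V] {r : ℕ}
    [Nonempty V] {A : V → V → ℝ} (hA : ∀ u v, |A u v| ≤ 1)
    {b z : V → ℝ} (hb : ∀ v, |b v| ≤ 1) (hz : ∀ v, |z v| ≤ 1) (hr : 0 < r) (θ : ℝ) :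
    𝔼 Y : Fin r → V, 𝔼 Z : Fin r → V, Real.exp (-θ * blockDual A b z Z Y) ≤
      Real.exp (-θ * (𝔼 Y : Fin r → V, 𝔼 Z : Fin r → V, blockDual A b z Z Y) +
        36 * θ ^ 2 / r) := by
  have hr' : (0 : ℝ) < r := by exact_mod_cast hr
  have hc : ∀ {p q : ℝ}, |p - q| ≤ 6 / r → |-θ * p - -θ * q| ≤ |θ| * (6 / r) := fun {p q} h => by
    rw [← mul_sub, abs_mul, abs_neg]
    gcongr
  have h1 : ∀ Y : Fin r → V, 𝔼 Z : Fin r → V, Real.exp (-θ * blockDual A b z Z Y) ≤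
      Real.exp (𝔼 Z : Fin r → V, -θ * blockDual A b z Z Y + r * (|θ| * (6 / r)) ^ 2 / 2) :=
    fun Y => expect_exp_le_of_bounded_differences fun Z i v =>
      hc (abs_blockDual_sub_update_left hA hb hz Z Y i v)
  refine (expect_le_expect fun Y _ => h1 Y).trans ?_
  refine (expect_exp_le_of_bounded_differences (c := |θ| * (6 / r)) fun Y i v => ?_).trans
    (le_of_eq ?_)
  · rw [add_sub_add_right_eq_sub, ← expect_sub_distrib]
    refine (abs_expect_le _ _).trans (expect_le univ_nonempty fun Z _ => ?_)
    exact hc (abs_blockDual_sub_update_right hA hb hz Z Y i v)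
  · congr 1
    rw [expect_add_distrib, Fintype.expect_const]
    simp_rw [← mul_expect]
    rw [mul_pow, sq_abs]
    field_simp
    ring

/-! ### The estimator and its upper tail -/

/-- The estimate of `A x` obtained from a sample `S` and guessed values `g` of `x` on it. -/
noncomputable def sampleGuess {V : Type*} {r : ℕ} (A : V → V → ℝ) (S : Fin r → V)
    (g : Fin r → Bool) (v : V) : ℝ :=
  𝔼 l, A v (S l) * boolSign (g l)

theorem abs_mul_boolSign_le {a : ℝ} (ha : |a| ≤ 1) (b : Bool) : |a * boolSign b| ≤ 1 := by
  rwa [abs_mul, abs_boolSign, mul_one]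

theorem abs_sampleGuess_le {V : Type*} {r : ℕ} {A : V → V → ℝ} (hA : ∀ u v, |A u v| ≤ 1)
    (hr : 0 < r) (S : Fin r → V) (g : Fin r → Bool) (v : V) : |sampleGuess A S g v| ≤ 1 :=
  abs_expect_le_one hr fun _ => abs_mul_boolSign_le (hA _ _) _

/-- The average of `blockValue` over all blocks, for guesses `p.1` on the seed sample and `p.2` on
the columns of the blocks. -/
noncomputable def sampleValue {V : Type*} {r K : ℕ} (A : V → V → ℝ)
    (ω : (Fin r → V) × (Fin K → (Fin r → V) × (Fin r → V)))
    (p : (Fin r → Bool) × (Fin K → Fin r → Bool)) : ℝ :=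
  𝔼 k, blockValue A (sampleGuess A ω.1 p.1) (ω.2 k).2 (ω.2 k).1 (p.2 k)

/-- The estimator: the minimum of `sampleValue` over all guesses. -/
noncomputable def sampleMin {V : Type*} {r K : ℕ} (A : V → V → ℝ)
    (ω : (Fin r → V) × (Fin K → (Fin r → V) × (Fin r → V))) : ℝ :=
  ⨅ p, sampleValue A ω p

/-- A bound for the error of `blockValue` when the guesses are the values of `x`. -/
noncomputable def blockError {V : Type*} [Fintype V] {r : ℕ} (A : V → V → ℝ) (x : V → Bool)
    (S Z Y : Fin r → V) : ℝ :=
  let M := fun v => 𝔼 w, A v w * boolSign (x w)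
  let β := fun v => |𝔼 l, A v (S l) * boolSign (x (S l)) - M v|
  𝔼 j, β (Y j) + |𝔼 j, M (Y j) * boolSign (x (Y j)) - 𝔼 v, M v * boolSign (x v)| +
    (𝔼 i, |𝔼 j, A (Z i) (Y j) * boolSign (x (Y j)) - M (Z i)| + 𝔼 i, β (Z i)) +
    (𝔼 i, |𝔼 j, A (Z i) (Y j) - 𝔼 w, A (Z i) w| +
      |𝔼 i, 𝔼 w, A (Z i) w - 𝔼 v, 𝔼 w, A v w|)

theorem blockError_nonneg {V : Type*} [Fintype V] {r : ℕ} (A : V → V → ℝ) (x : V → Bool)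
    (S Z Y : Fin r → V) : 0 ≤ blockError A x S Z Y := by
  have h : ∀ f : Fin r → ℝ, 0 ≤ 𝔼 j, |f j| := fun f => expect_nonneg fun j _ => abs_nonneg _
  unfold blockError
  refine add_nonneg (add_nonneg (add_nonneg (h _) (abs_nonneg _)) (add_nonneg (h _) (h _)))
    (add_nonneg (h _) (abs_nonneg _))

theorem blockValue_le {V : Type*} [Fintype V] {r : ℕ} (A : V → V → ℝ) (x : V → Bool)
    (S Z Y : Fin r → V) :
    blockValue A (sampleGuess A S fun l => x (S l)) Z Y (fun j => x (Y j)) ≤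
      𝔼 u, 𝔼 v, A u v + avgForm A (fun v => boolSign (x v)) + blockError A x S Z Y := by
  set M := fun v => 𝔼 w, A v w * boolSign (x w) with hM
  set b := sampleGuess A S fun l => x (S l) with hb
  have hq : avgForm A (fun v => boolSign (x v)) = 𝔼 v, M v * boolSign (x v) := by
    refine expect_congr rfl fun v _ => ?_
    rw [hM, expect_mul]
    exact expect_congr rfl fun w _ => by ring
  have h1 : 𝔼 j, b (Y j) * boolSign (x (Y j)) ≤
      𝔼 j, |b (Y j) - M (Y j)| + 𝔼 j, M (Y j) * boolSign (x (Y j)) := by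
    rw [← expect_add_distrib]
    refine expect_le_expect fun j _ => ?_
    have : (b (Y j) - M (Y j)) * boolSign (x (Y j)) ≤ |b (Y j) - M (Y j)| := by
      refine (le_abs_self _).trans ?_
      rw [abs_mul, abs_boolSign, mul_one]
    linarith
  have h2 : 𝔼 i, |𝔼 j, A (Z i) (Y j) * boolSign (x (Y j)) - b (Z i)| ≤
      𝔼 i, |𝔼 j, A (Z i) (Y j) * boolSign (x (Y j)) - M (Z i)| + 𝔼 i, |b (Z i) - M (Z i)| := by
    rw [← expect_add_distrib]
    refine expect_le_expect fun i _ => ?_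
    rw [abs_sub_comm (b (Z i))]
    exact abs_sub_le _ _ _
  have h3 : 𝔼 i, 𝔼 j, A (Z i) (Y j) ≤
      𝔼 i, |𝔼 j, A (Z i) (Y j) - 𝔼 w, A (Z i) w| + 𝔼 i, 𝔼 w, A (Z i) w := by
    rw [← expect_add_distrib]
    refine expect_le_expect fun i _ => ?_
    have := le_abs_self (𝔼 j, A (Z i) (Y j) - 𝔼 w, A (Z i) w)
    linarith
  have h4 := le_abs_self (𝔼 j, M (Y j) * boolSign (x (Y j)) - 𝔼 v, M v * boolSign (x v))
  have h5 := le_abs_self (𝔼 i, 𝔼 w, A (Z i) w - 𝔼 v, 𝔼 w, A v w)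
  have e : blockError A x S Z Y = 𝔼 j, |b (Y j) - M (Y j)| +
      |𝔼 j, M (Y j) * boolSign (x (Y j)) - 𝔼 v, M v * boolSign (x v)| +
      (𝔼 i, |𝔼 j, A (Z i) (Y j) * boolSign (x (Y j)) - M (Z i)| + 𝔼 i, |b (Z i) - M (Z i)|) +
      (𝔼 i, |𝔼 j, A (Z i) (Y j) - 𝔼 w, A (Z i) w| +
        |𝔼 i, 𝔼 w, A (Z i) w - 𝔼 v, 𝔼 w, A v w|) := rfl
  rw [blockValue, hq, e]
  linarith

/-- Each of the six summands is a mean absolute deviation of an `r`-sample average, hence at most `1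
/ √r` in expectation. -/
theorem expect_blockError_le {V : Type*} [Fintype V] [Nonempty V] {r : ℕ} {A : V → V → ℝ}
    (hA : ∀ u v, |A u v| ≤ 1) (x : V → Bool) (hr : 0 < r) :
    𝔼 S : Fin r → V, 𝔼 Y : Fin r → V, 𝔼 Z : Fin r → V, blockError A x S Z Y ≤ 6 / √r := by
  have : Nonempty (Fin r) := ⟨⟨0, hr⟩⟩
  set M := fun v => 𝔼 w, A v w * boolSign (x w) with hM
  have hAx : ∀ v w, |A v w * boolSign (x w)| ≤ 1 := fun v w => abs_mul_boolSign_le (hA _ _) _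
  have habs : ∀ h : V → ℝ, (∀ v, |h v| ≤ 1) → |𝔼 v, h v| ≤ 1 := fun h hh =>
    (abs_expect_le _ _).trans (expect_le univ_nonempty fun i _ => hh i)
  have hβ : 𝔼 S : Fin r → V, 𝔼 v, |𝔼 l, A v (S l) * boolSign (x (S l)) - M v| ≤ 1 / √r := by
    rw [expect_comm]
    exact expect_le univ_nonempty fun v _ => expect_abs_expect_sub_le (hAx v) hr
  have h2 := expect_abs_expect_sub_le (h := fun v => M v * boolSign (x v))
    (fun v => abs_mul_boolSign_le (habs _ (hAx v)) _) hr
  have hrow : ∀ h : V → V → ℝ, (∀ v w, |h v w| ≤ 1) →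
      𝔼 Y : Fin r → V, 𝔼 v, |𝔼 j, h v (Y j) - 𝔼 w, h v w| ≤ 1 / √r := fun h hh => by
    rw [expect_comm]
    exact expect_le univ_nonempty fun v _ => expect_abs_expect_sub_le (hh v) hr
  have h3 := hrow (fun v w => A v w * boolSign (x w)) hAx
  have h4 := hrow A hA
  have h5 := expect_abs_expect_sub_le (h := fun v => 𝔼 w, A v w) (fun v => habs _ (hA v)) hr
  have e : 𝔼 S : Fin r → V, 𝔼 Y : Fin r → V, 𝔼 Z : Fin r → V, blockError A x S Z Y =
      𝔼 S : Fin r → V, 𝔼 v, |𝔼 l, A v (S l) * boolSign (x (S l)) - M v| +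
      𝔼 Y : Fin r → V, |𝔼 j, M (Y j) * boolSign (x (Y j)) - 𝔼 v, M v * boolSign (x v)| +
      (𝔼 Y : Fin r → V, 𝔼 v, |𝔼 j, A v (Y j) * boolSign (x (Y j)) - M v| +
        𝔼 S : Fin r → V, 𝔼 v, |𝔼 l, A v (S l) * boolSign (x (S l)) - M v|) +
      (𝔼 Y : Fin r → V, 𝔼 v, |𝔼 j, A v (Y j) - 𝔼 w, A v w| +
        𝔼 Z : Fin r → V, |𝔼 i, 𝔼 w, A (Z i) w - 𝔼 v, 𝔼 w, A v w|) := by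
    have e1 : ∀ S : Fin r → V,
        𝔼 Y : Fin r → V, 𝔼 j, |𝔼 l, A (Y j) (S l) * boolSign (x (S l)) - M (Y j)| =
        𝔼 v, |𝔼 l, A v (S l) * boolSign (x (S l)) - M v| := fun S =>
      expect_expect_eval hr fun v => |𝔼 l, A v (S l) * boolSign (x (S l)) - M v|
    have e3 : ∀ Y : Fin r → V, 𝔼 Z : Fin r → V, 𝔼 i, |𝔼 j, A (Z i) (Y j) - 𝔼 w, A (Z i) w| =
        𝔼 v, |𝔼 j, A v (Y j) - 𝔼 w, A v w| := fun Y =>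
      expect_expect_eval hr fun v => |𝔼 j, A v (Y j) - 𝔼 w, A v w|
    have e0 : ∀ S Z Y : Fin r → V, blockError A x S Z Y =
        𝔼 j, |𝔼 l, A (Y j) (S l) * boolSign (x (S l)) - M (Y j)| +
        |𝔼 j, M (Y j) * boolSign (x (Y j)) - 𝔼 v, M v * boolSign (x v)| +
        (𝔼 i, |𝔼 j, A (Z i) (Y j) * boolSign (x (Y j)) - M (Z i)| +
          𝔼 i, |𝔼 l, A (Z i) (S l) * boolSign (x (S l)) - M (Z i)|) +
        (𝔼 i, |𝔼 j, A (Z i) (Y j) - 𝔼 w, A (Z i) w| +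
          |𝔼 i, 𝔼 w, A (Z i) w - 𝔼 v, 𝔼 w, A v w|) := fun _ _ _ => rfl
    simp only [e0, expect_add_distrib, Fintype.expect_const, e1, e3]
  rw [e]
  have e6 : 6 / √(r : ℝ) = 1 / √r + 1 / √r + (1 / √r + 1 / √r) + (1 / √r + 1 / √r) := by ring
  rw [e6]
  gcongr

/-- With high probability the estimator is not much larger than the optimum. -/
theorem card_lt_sampleMin_le {V : Type*} [Fintype V] [Nonempty V] {r K : ℕ} {A : V → V → ℝ}
    (hA : ∀ u v, |A u v| ≤ 1) (x : V → Bool) (hr : 0 < r) (hK : 0 < K) {s : ℝ} (hs : 0 < s)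
    (hrs : 6 / √r ≤ 1 / 20 * s) :
    ((univ.filter fun ω : (Fin r → V) × (Fin K → (Fin r → V) × (Fin r → V)) =>
      𝔼 u, 𝔼 v, A u v + avgForm A (fun v => boolSign (x v)) + s < sampleMin A ω).card : ℝ) ≤
      1 / 20 * Fintype.card ((Fin r → V) × (Fin K → (Fin r → V) × (Fin r → V))) := by
  have : Nonempty (Fin K) := ⟨⟨0, hK⟩⟩
  let f : (Fin r → V) × (Fin K → (Fin r → V) × (Fin r → V)) → ℝ := fun ω =>
    𝔼 k, blockError A x ω.1 (ω.2 k).2 (ω.2 k).1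
  have hf : 𝔼 ω, f ω ≤ 1 / 20 * s := by
    refine le_trans (le_of_eq ?_) ((expect_blockError_le hA x hr).trans hrs)
    rw [← univ_product_univ, expect_product]
    refine expect_congr rfl fun S _ => ?_
    simp only [f]
    rw [expect_comm]
    have : ∀ k : Fin K, 𝔼 w : Fin K → (Fin r → V) × (Fin r → V),
        blockError A x S (w k).2 (w k).1 =
        𝔼 Y : Fin r → V, 𝔼 Z : Fin r → V, blockError A x S Z Y := fun k => by
      rw [expect_pi_eval k fun B : (Fin r → V) × (Fin r → V) => blockError A x S B.2 B.1,
        ← univ_product_univ, expect_product]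
    simp_rw [this]
    exact Fintype.expect_const _
  have hmark := card_filter_le_of_expect f
    (fun ω => expect_nonneg fun k _ => blockError_nonneg _ _ _ _ _) hs hf
  refine le_trans ?_ hmark
  norm_cast
  refine card_le_card fun ω hω => ?_
  rw [mem_filter] at hω ⊢
  refine ⟨hω.1, ?_⟩
  have h1 : sampleMin A ω ≤ sampleValue A ω (fun l => x (ω.1 l), fun k j => x ((ω.2 k).1 j)) :=
    ciInf_le (Set.finite_range _).bddBelow _
  have h2 : sampleValue A ω (fun l => x (ω.1 l), fun k j => x ((ω.2 k).1 j)) ≤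
      𝔼 u, 𝔼 v, A u v + avgForm A (fun v => boolSign (x v)) + f ω := by
    rw [← Fintype.expect_const (ι := Fin K) (𝔼 u, 𝔼 v, A u v + avgForm A fun v => boolSign (x v)),
      ← expect_add_distrib]
    exact expect_le_expect fun k _ => blockValue_le A x ω.1 (ω.2 k).2 (ω.2 k).1
  linarith [hω.2]

/-! ### The lower tail -/

theorem expect_exp_sum_blockDual_le {V : Type*} [Fintype V] [Nonempty V] {r : ℕ} (K : ℕ)
    {A : V → V → ℝ} (hA : ∀ u v, |A u v| ≤ 1)
    {b z : V → ℝ} (hb : ∀ v, |b v| ≤ 1) (hz : ∀ v, |z v| ≤ 1) (hr : 0 < r) {m s : ℝ} (hs : 0 ≤ s)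
    (hm : m + s ≤ 𝔼 Y : Fin r → V, 𝔼 Z : Fin r → V, blockDual A b z Z Y) :
    𝔼 w : Fin K → (Fin r → V) × (Fin r → V),
      Real.exp (∑ k, s * r / 72 * (m - blockDual A b z (w k).2 (w k).1)) ≤
      Real.exp (-(K * (s ^ 2 * r / 144))) := by
  have hr' : (0 : ℝ) < r := by exact_mod_cast hr
  -- This `θ` minimizes the exponent `-θ * s + 36 * θ ^ 2 / r`, with value `-s ^ 2 * r / 144`.
  set θ := s * r / 72 with hθ
  have hθ0 : 0 ≤ θ := by positivity
  have h1 : 𝔼 B : (Fin r → V) × (Fin r → V), Real.exp (θ * (m - blockDual A b z B.2 B.1)) ≤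
      Real.exp (-(s ^ 2 * r / 144)) := by
    rw [← univ_product_univ, expect_product]
    have e : ∀ Y Z : Fin r → V, Real.exp (θ * (m - blockDual A b z Z Y)) =
        Real.exp (θ * m) * Real.exp (-θ * blockDual A b z Z Y) := fun Y Z => by
      rw [← Real.exp_add]; ring_nf
    simp_rw [e, ← mul_expect]
    refine (mul_le_mul_of_nonneg_left (expect_exp_blockDual_le hA hb hz hr θ)
      (Real.exp_pos _).le).trans ?_
    rw [← Real.exp_add, Real.exp_le_exp]
    have h2 := mul_le_mul_of_nonneg_left hm hθ0
    have h3 : 36 * θ ^ 2 / r = θ * s - s ^ 2 * r / 144 := by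
      rw [hθ]; field_simp; ring
    linarith
  simp_rw [Real.exp_sum]
  have := expect_pow univ
    (fun B : (Fin r → V) × (Fin r → V) => Real.exp (θ * (m - blockDual A b z B.2 B.1))) K
  rw [Fintype.piFinset_univ] at this
  rw [← this]
  refine (pow_le_pow_left₀ (expect_nonneg fun _ _ => (Real.exp_pos _).le) h1 K).trans (le_of_eq ?_)
  rw [← Real.exp_nat_mul]
  ring_nf

/-- With high probability the estimator is not much smaller than the optimum. -/
theorem card_sampleMin_lt_le {V : Type*} [Fintype V] [Nonempty V] {r K : ℕ} {A : V → V → ℝ}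
    (hA : ∀ u v, |A u v| ≤ 1) (hA0 : ∀ v, A v v = 0) {q : ℝ}
    (hq : ∀ f : V → Bool, q ≤ avgForm A fun v => boolSign (f v)) (hr : 0 < r) (hK : 0 < K) {s : ℝ}
    (hs : 0 < s) (hrs : 1 / √r ≤ s) (hKs : 720 ≤ K * s ^ 2) :
    ((univ.filter fun ω : (Fin r → V) × (Fin K → (Fin r → V) × (Fin r → V)) =>
      sampleMin A ω < 𝔼 u, 𝔼 v, A u v + q - 2 * s).card : ℝ) ≤
      1 / 20 * Fintype.card ((Fin r → V) × (Fin K → (Fin r → V) × (Fin r → V))) := by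
  have : Nonempty (Fin K) := ⟨⟨0, hK⟩⟩
  have hr' : (1 : ℝ) ≤ r := by exact_mod_cast hr
  set m := 𝔼 u, 𝔼 v, A u v + q - 2 * s with hm
  -- The certificate depends on the seed and its pattern only, so for fixed `S` and `g` the blocks
  -- are independent of it.
  choose z hz hzq using fun (S : Fin r → V) (g : Fin r → Bool) =>
    exists_dual_certificate hA0 hq (sampleGuess A S g)
  let f : (Fin r → V) × (Fin K → (Fin r → V) × (Fin r → V)) → ℝ := fun ω =>
    ∑ g : Fin r → Bool, Real.exp (∑ k, s * r / 72 *
      (m - blockDual A (sampleGuess A ω.1 g) (z ω.1 g) (ω.2 k).2 (ω.2 k).1))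
  have hf : 𝔼 ω, f ω ≤ 1 / 20 * 1 := by
    rw [← univ_product_univ, expect_product]
    refine expect_le univ_nonempty fun S _ => ?_
    simp only [f]
    rw [expect_sum_comm]
    have h1 : ∀ g : Fin r → Bool, 𝔼 w : Fin K → (Fin r → V) × (Fin r → V),
        Real.exp (∑ k, s * r / 72 *
          (m - blockDual A (sampleGuess A S g) (z S g) (w k).2 (w k).1)) ≤
        Real.exp (-(K * (s ^ 2 * r / 144))) := fun g => by
      refine expect_exp_sum_blockDual_le K hA (abs_sampleGuess_le hA hr S g) (hz S g) hr hs.le ?_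
      have := le_expect_blockDual hA (sampleGuess A S g) (hz S g) hr
      linarith [hzq S g]
    refine (sum_le_sum fun g _ => h1 g).trans ?_
    rw [sum_const, card_univ, Fintype.card_fun, Fintype.card_bool, Fintype.card_fin, nsmul_eq_mul]
    have h2 : ((2 ^ r : ℕ) : ℝ) ≤ Real.exp r := by
      rw [← Real.exp_one_pow]
      push_cast
      gcongr
      linarith [Real.exp_one_gt_d9]
    -- Since `720 / 144 = 5`, each pattern fails with probability at most `exp (-5 * r)`, which
    -- beats the `2 ^ r ≤ exp r` patterns.
    have h3 : Real.exp (-(K * (s ^ 2 * r / 144))) ≤ Real.exp (-(5 * r)) := by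
      rw [Real.exp_le_exp]
      nlinarith
    refine (mul_le_mul h2 h3 (Real.exp_pos _).le (Real.exp_pos _).le).trans ?_
    rw [← Real.exp_add]
    have h4 : Real.exp (r + -(5 * r)) ≤ Real.exp (-4) := Real.exp_le_exp.2 (by linarith)
    refine h4.trans ?_
    have h5 : (20 : ℝ) ≤ Real.exp 4 := by
      have : Real.exp 4 = Real.exp 1 ^ 4 := by rw [Real.exp_one_pow]; norm_num
      rw [this]
      calc (20 : ℝ) ≤ 2.7 ^ 4 := by norm_num
        _ ≤ _ := by gcongr; linarith [Real.exp_one_gt_d9]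
    rw [Real.exp_neg, mul_one, one_div]
    gcongr
  have hmark := card_filter_le_of_expect f
    (fun ω => sum_nonneg fun g _ => (Real.exp_pos _).le) one_pos hf
  refine le_trans ?_ hmark
  norm_cast
  refine card_le_card fun ω hω => ?_
  rw [mem_filter] at hω ⊢
  refine ⟨hω.1, ?_⟩
  obtain ⟨p, hp⟩ := exists_eq_ciInf_of_finite (f := sampleValue A ω)
  have h1 : sampleValue A ω p < m := hp.trans_lt hω.2
  have h2 : 𝔼 k, blockDual A (sampleGuess A ω.1 p.1) (z ω.1 p.1) (ω.2 k).2 (ω.2 k).1 ≤ m :=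
    le_trans (expect_le_expect fun k _ => blockDual_le_blockValue A _ (hz ω.1 p.1) _ _ _) h1.le
  -- On a bad sample the exponent for the minimizing seed pattern is nonnegative, so `f ω ≥ 1` and
  -- Markov's inequality applies with threshold `1`.
  have h3 : 0 ≤ ∑ k, s * r / 72 *
      (m - blockDual A (sampleGuess A ω.1 p.1) (z ω.1 p.1) (ω.2 k).2 (ω.2 k).1) := by
    rw [← mul_sum, ← Fintype.card_mul_expect, expect_sub_distrib, Fintype.expect_const]
    have := sub_nonneg.2 h2
    positivity
  refine (Real.one_le_exp h3).trans ?_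
  exact single_le_sum (f := fun g => Real.exp (∑ k, s * r / 72 *
      (m - blockDual A (sampleGuess A ω.1 g) (z ω.1 g) (ω.2 k).2 (ω.2 k).1)))
    (fun g _ => (Real.exp_pos _).le) (mem_univ p.1)

/-! ### Query count and the algorithms -/

theorem sampleMin_adjIndicator_congr {V : Type*} {r K : ℕ} {G G' : SimpleGraph V}
    (ω : (Fin r → V) × (Fin K → (Fin r → V) × (Fin r → V)))
    (hZY : ∀ k i j, G.Adj ((ω.2 k).2 i) ((ω.2 k).1 j) ↔ G'.Adj ((ω.2 k).2 i) ((ω.2 k).1 j))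
    (hYS : ∀ k i j, G.Adj ((ω.2 k).1 i) (ω.1 j) ↔ G'.Adj ((ω.2 k).1 i) (ω.1 j))
    (hZS : ∀ k i j, G.Adj ((ω.2 k).2 i) (ω.1 j) ↔ G'.Adj ((ω.2 k).2 i) (ω.1 j)) :
    sampleMin (adjIndicator G) ω = sampleMin (adjIndicator G') ω := by
  have h : ∀ {u v}, (G.Adj u v ↔ G'.Adj u v) → adjIndicator G u v = adjIndicator G' u v :=
    fun h => by unfold adjIndicator; congr 1; exact propext h
  simp only [sampleMin, sampleValue, blockValue, sampleGuess, h (hZY _ _ _), h (hYS _ _ _),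
    h (hZS _ _ _)]

theorem card_union_le_of_le_half {Ω : Type*} [Fintype Ω] [DecidableEq Ω] {B₁ B₂ : Finset Ω}
    (h₁ : (B₁.card : ℝ) ≤ 1 / 20 * Fintype.card Ω) (h₂ : (B₂.card : ℝ) ≤ 1 / 20 * Fintype.card Ω) :
    ((B₁ ∪ B₂).card : ℝ) ≤ 1 / 10 * Fintype.card Ω := by
  have : ((B₁ ∪ B₂).card : ℝ) ≤ B₁.card + B₂.card := by exact_mod_cast card_union_le B₁ B₂
  linarith

/-- The bipartite distance is estimated up to `ε n ^ 2` with `O(1 / ε ^ 6)` adjacency queries. -/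
theorem exists_estimator (n : ℕ) {ε : ℝ} (hε : 0 < ε) (hε1 : ε < 1) :
    ∃ A : RandQueryAlg (Fin n) ℝ,
      A.QueriesAtMost (softSixth (3 * 721 * 3601 ^ 2) 0 (1 / ε)) ∧
      ∀ G : SimpleGraph (Fin n), 9 / 10 ≤ A.probOutput G
        {x : ℝ | (bipDist G : ℝ) - ε * (n : ℝ) ^ 2 ≤ x ∧
          x ≤ (bipDist G : ℝ) + ε * (n : ℝ) ^ 2} := by
  rcases Nat.eq_zero_or_pos n with rfl | hn
  · refine ⟨_, RandQueryAlg.queriesAtMost_pure_output 0 ?_, fun G =>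
      RandQueryAlg.probOutput_pure_output ?_ G⟩
    · rw [softSixth]; positivity
    · have : bipDist G = 0 := by simpa using bipDist_le G
      simp [this]
  have : Nonempty (Fin n) := ⟨⟨0, hn⟩⟩
  have hn0 : (0 : ℝ) < n := by exact_mod_cast hn
  -- `√r ≥ 60 / ε` makes the mean upper error `6 / √r` at most `ε / 10`, that is `1 / 20` of the
  -- tolerance `2 * ε`. The value of `K` gives `K * ε ^ 2 ≥ 720`.
  set r := ⌈3600 / ε ^ 2⌉₊ with hr_def
  set K := ⌈720 / ε ^ 2⌉₊ with hK_def
  have hε2 : 0 < ε ^ 2 := by positivity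
  have hε2' : 1 ≤ 1 / ε ^ 2 := by
    rw [le_div_iff₀ hε2, one_mul]
    exact pow_le_one₀ hε.le hε1.le
  have hr : 0 < r := Nat.ceil_pos.2 (by positivity)
  have hK : 0 < K := Nat.ceil_pos.2 (by positivity)
  have hr1 : 3600 / ε ^ 2 ≤ r := Nat.le_ceil _
  have hK1 : 720 / ε ^ 2 ≤ K := Nat.le_ceil _
  have hr2 : (r : ℝ) ≤ 3601 / ε ^ 2 := by
    have := (Nat.ceil_lt_add_one (show 0 ≤ 3600 / ε ^ 2 by positivity)).le
    refine this.trans ?_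
    rw [show 3601 / ε ^ 2 = 3600 / ε ^ 2 + 1 / ε ^ 2 by ring]
    linarith
  have hK2 : (K : ℝ) ≤ 721 / ε ^ 2 := by
    have := (Nat.ceil_lt_add_one (show 0 ≤ 720 / ε ^ 2 by positivity)).le
    refine this.trans ?_
    rw [show 721 / ε ^ 2 = 720 / ε ^ 2 + 1 / ε ^ 2 by ring]
    linarith
  have hsqrt : 60 / ε ≤ √r := by
    refine Real.le_sqrt_of_sq_le (le_trans (le_of_eq ?_) hr1)
    rw [div_pow]; norm_num
  have hsqrt0 : 0 < √(r : ℝ) := lt_of_lt_of_le (by positivity) hsqrt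
  have hinv : 1 / √r ≤ ε / 60 := by
    rw [div_le_iff₀ hsqrt0]
    rw [div_le_iff₀ hε] at hsqrt
    linarith
  let Q := Fin K × Fin r × Fin r
  let e : ((Fin r → Fin n) × (Fin K → (Fin r → Fin n) × (Fin r → Fin n))) →
      Q ⊕ Q ⊕ Q → Fin n × Fin n := fun ω =>
    Sum.elim (fun p => ((ω.2 p.1).2 p.2.1, (ω.2 p.1).1 p.2.2))
      (Sum.elim (fun p => ((ω.2 p.1).1 p.2.1, ω.1 p.2.2))
        (fun p => ((ω.2 p.1).2 p.2.1, ω.1 p.2.2)))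
  obtain ⟨A, hA, hprob⟩ := RandQueryAlg.exists_of_uniform e
    (fun ω G => (n : ℝ) ^ 2 / 2 * sampleMin (adjIndicator G) ω) (fun ω G G' h => by
      rw [sampleMin_adjIndicator_congr ω (fun k i j => h (Sum.inl (k, i, j)))
        (fun k i j => h (Sum.inr (Sum.inl (k, i, j))))
        (fun k i j => h (Sum.inr (Sum.inr (k, i, j))))])
  refine ⟨A, hA.mono ?_, fun G => ?_⟩
  · have hcard : ((Fintype.card (Q ⊕ Q ⊕ Q) : ℕ) : ℝ) = 3 * K * r ^ 2 := by
      simp only [Q, Fintype.card_sum, Fintype.card_prod, Fintype.card_fin]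
      push_cast
      ring
    rw [hcard, softSixth, pow_zero, mul_one]
    calc 3 * (K : ℝ) * r ^ 2 ≤ 3 * (721 / ε ^ 2) * (3601 / ε ^ 2) ^ 2 := by gcongr
      _ = _ := by ring
  · obtain ⟨f₀, hmin, hdist⟩ := exists_bipDist_eq G
    rw [Fintype.card_fin] at hdist
    have hup := card_lt_sampleMin_le (K := K) (abs_adjIndicator_le G) f₀ hr hK
      (show 0 < 2 * ε by positivity)
      (by rw [show 6 / √(r : ℝ) = 6 * (1 / √r) by ring]; linarith)
    have hlow := card_sampleMin_lt_le (K := K) (abs_adjIndicator_le G) (adjIndicator_self G) hmin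
      hr hK hε (by linarith) (by rwa [div_le_iff₀ hε2] at hK1)
    refine hprob G _ _ (fun ω hω => ?_) (card_union_le_of_le_half hup hlow)
    simp only [mem_union, mem_filter, mem_univ, true_and, not_or, not_lt] at hω
    have hn2 : 0 ≤ (n : ℝ) ^ 2 / 2 := by positivity
    have h1 := mul_le_mul_of_nonneg_left hω.1 hn2
    have h2 := mul_le_mul_of_nonneg_left hω.2 hn2
    simp only [Set.mem_ofPred_eq]
    rw [hdist]
    constructor <;> linarith

/-- Accuracy `δ n ^ 2` suffices to decide a gap of `3 δ n ^ 2`. -/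
theorem exists_decider {n : ℕ} (hn : 1 ≤ n) {δ : ℝ} (hδ : 0 < δ) (hδ1 : δ < 1) {a b : ℝ}
    (hab : a + 3 * δ * (n : ℝ) ^ 2 ≤ b) :
    ∃ A : RandQueryAlg (Fin n) Bool,
      A.QueriesAtMost (softSixth (3 * 721 * 3601 ^ 2) 0 (1 / δ)) ∧ A.DecidesBipDist a b := by
  obtain ⟨A, hA, hprob⟩ := exists_estimator n hδ hδ1
  have hn2 : 0 < δ * (n : ℝ) ^ 2 := by positivity
  -- Thresholding at `a + δ * n ^ 2` is correct: when `bipDist G ≥ b` the estimate is at least `a +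
  -- 2 * δ * n ^ 2`.
  refine ⟨A.mapOutput fun x => decide (x ≤ a + δ * (n : ℝ) ^ 2), hA.mapOutput _,
    fun G => ⟨fun h => ?_, fun h => ?_⟩⟩ <;>
  · rw [RandQueryAlg.probOutput_mapOutput]
    refine (hprob G).trans (RandQueryAlg.probOutput_mono fun x hx => ?_)
    obtain ⟨h1, h2⟩ := hx
    simp only [Set.mem_preimage, Set.mem_singleton_iff, decide_eq_true_eq, decide_eq_false_iff_not,
      not_le]
    linarith

theorem softSixth_one_div_third (C x : ℝ) :
    softSixth C 0 (1 / (x / 3)) = softSixth (3 ^ 6 * C) 0 (1 / x) := by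
  simp only [softSixth, pow_zero, mul_one]
  rw [one_div_div, div_pow, div_pow]
  ring

theorem mainTheorem4 :
    -- estimation of the bipartite distance
    (∃ (C : ℝ) (m : ℕ) (A : (n : ℕ) → ℝ → RandQueryAlg (Fin n) ℝ),
      ∀ (n : ℕ) (ε : ℝ), 0 < ε → ε < 1 →
        (A n ε).QueriesAtMost (softSixth C m (1 / ε)) ∧
        ∀ G : SimpleGraph (Fin n),
          9 / 10 ≤ (A n ε).probOutput G
            {x : ℝ | (bipDist G : ℝ) - ε * (n : ℝ) ^ 2 ≤ x ∧
              x ≤ (bipDist G : ℝ) + ε * (n : ℝ) ^ 2}) ∧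
    -- tolerant testing with gap factor `2 + c`
    (∃ (C : ℝ) (m : ℕ) (A : (n : ℕ) → ℝ → ℝ → RandQueryAlg (Fin n) Bool),
      ∀ (n : ℕ) (ε c : ℝ), 1 ≤ n → 0 < ε → ε < 1 → 0 < c →
        (A n ε c).QueriesAtMost (softSixth C m (1 / ε)) ∧
        (A n ε c).DecidesBipDist (ε * (n : ℝ) ^ 2) ((2 + c) * ε * (n : ℝ) ^ 2)) ∧
    -- tolerant testing with gap factor `1 + k`
    (∃ (C : ℝ) (m : ℕ) (A : (n : ℕ) → ℝ → ℝ → RandQueryAlg (Fin n) Bool),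
      ∀ (n : ℕ) (ε k : ℝ), 1 ≤ n → 0 < ε → ε < 1 → 0 < k →
        (A n ε k).QueriesAtMost (softSixth C m (1 / (k * ε))) ∧
        (A n ε k).DecidesBipDist (ε * (n : ℝ) ^ 2) ((1 + k) * ε * (n : ℝ) ^ 2)) := by
  refine ⟨⟨3 * 721 * 3601 ^ 2, 0, ?_⟩, ⟨3 ^ 6 * (3 * 721 * 3601 ^ 2), 0, ?_⟩,
    ⟨3 ^ 6 * (3 * 721 * 3601 ^ 2), 0, ?_⟩⟩
  · have h : ∀ (n : ℕ) (ε : ℝ), ∃ A : RandQueryAlg (Fin n) ℝ, 0 < ε → ε < 1 →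
        A.QueriesAtMost (softSixth (3 * 721 * 3601 ^ 2) 0 (1 / ε)) ∧
        ∀ G : SimpleGraph (Fin n), 9 / 10 ≤ A.probOutput G
          {x : ℝ | (bipDist G : ℝ) - ε * (n : ℝ) ^ 2 ≤ x ∧
            x ≤ (bipDist G : ℝ) + ε * (n : ℝ) ^ 2} := fun n ε => by
      by_cases hε : 0 < ε ∧ ε < 1
      · obtain ⟨A, hA⟩ := exists_estimator n hε.1 hε.2
        exact ⟨A, fun _ _ => hA⟩
      · exact ⟨PMF.pure (.output 0), fun h0 h1 => absurd ⟨h0, h1⟩ hε⟩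
    choose A hA using h
    exact ⟨A, hA⟩
  · have h : ∀ (n : ℕ) (ε c : ℝ), ∃ A : RandQueryAlg (Fin n) Bool, 1 ≤ n → 0 < ε → ε < 1 → 0 < c →
        A.QueriesAtMost (softSixth (3 ^ 6 * (3 * 721 * 3601 ^ 2)) 0 (1 / ε)) ∧
        A.DecidesBipDist (ε * (n : ℝ) ^ 2) ((2 + c) * ε * (n : ℝ) ^ 2) := fun n ε c => by
      by_cases hε : 1 ≤ n ∧ 0 < ε ∧ ε < 1 ∧ 0 < c
      · obtain ⟨hn, hε, hε1, hc⟩ := hε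
        have hn2 : 0 ≤ c * ε * (n : ℝ) ^ 2 := by positivity
        -- The gap is `(1 + c) * ε * n ^ 2`, of which `ε * n ^ 2` already suffices.
        obtain ⟨A, hA⟩ := exists_decider hn (δ := ε / 3) (by linarith) (by linarith)
          (a := ε * (n : ℝ) ^ 2) (b := (2 + c) * ε * (n : ℝ) ^ 2) (by linarith)
        rw [softSixth_one_div_third] at hA
        exact ⟨A, fun _ _ _ _ => hA⟩
      · exact ⟨PMF.pure (.output true), fun h0 h1 h2 h3 => absurd ⟨h0, h1, h2, h3⟩ hε⟩
    choose A hA using h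
    exact ⟨A, hA⟩
  · have h : ∀ (n : ℕ) (ε k : ℝ), ∃ A : RandQueryAlg (Fin n) Bool, 1 ≤ n → 0 < ε → ε < 1 → 0 < k →
        A.QueriesAtMost (softSixth (3 ^ 6 * (3 * 721 * 3601 ^ 2)) 0 (1 / (k * ε))) ∧
        A.DecidesBipDist (ε * (n : ℝ) ^ 2) ((1 + k) * ε * (n : ℝ) ^ 2) := fun n ε k => by
      by_cases hε : 1 ≤ n ∧ 0 < ε ∧ ε < 1 ∧ 0 < k
      · obtain ⟨hn, hε, hε1, hk⟩ := hε
        have hkε : 0 < k * ε := mul_pos hk hε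
        -- Accuracy `k * ε / 3` must be below `1`. Otherwise the upper threshold exceeds `n ^ 2 ≥
        -- bipDist G`, so answering `true` without queries is correct.
        by_cases hlt : k * ε < 3
        · obtain ⟨A, hA⟩ := exists_decider hn (δ := k * ε / 3) (by linarith) (by linarith)
            (a := ε * (n : ℝ) ^ 2) (b := (1 + k) * ε * (n : ℝ) ^ 2) (by linarith)
          rw [softSixth_one_div_third] at hA
          exact ⟨A, fun _ _ _ _ => hA⟩
        · refine ⟨PMF.pure (.output true), fun _ _ _ _ =>
            ⟨RandQueryAlg.queriesAtMost_pure_output _ (by rw [softSixth]; positivity), fun G =>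
              ⟨fun _ => RandQueryAlg.probOutput_pure_output (Set.mem_singleton _) G, fun h => ?_⟩⟩⟩
          have h1 : (bipDist G : ℝ) ≤ (n : ℝ) ^ 2 := by
            have := bipDist_le G
            rw [Fintype.card_fin] at this
            exact_mod_cast this
          have hn2 : 0 < (n : ℝ) ^ 2 := by positivity
          nlinarith
      · exact ⟨PMF.pure (.output true), fun h0 h1 h2 h3 => absurd ⟨h0, h1, h2, h3⟩ hε⟩
    choose A hA using h
    exact ⟨A, hA⟩
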